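/- For $d\in\{1,2\}$, $t>0$ and $x,y\in\mathbb{R}^d$ let $g(t,x,y)=(4\pi t)^{-d/2}e^{-|y-x|^2/(4t)}$. For a Borel measurable function $V:\mathbb{R}^d\to\mathbb{R}$ and $T>0$ put $$S(V,t,x,y)=\int_0^t\int_{\mathbb{R}^d}\frac{g(s,x,z)\,g(t-s,z,y)}{g(t,x,y)}\,|V(z)|\,dz\,ds,\qquad \|S(V)\|_{T,\infty}=\sup_{0<t\le T}\ \sup_{x,y\in\mathbb{R}^d}S(V,t,x,y).$$ There is an absolute constant $c>0$ such that for $d=1$ and $d=2$, for all $T>0$ and all Borel measurable $V:\mathbb{R}^d\to\mathbb{R}$, $$c^{-1}\sup_{x\in\mathbb{R}^d}\int_0^T\int_{\mathbb{R}^d}g(s,x,z)\,|V(z)|\,dz\,ds\ \le\ \|S(V)\|_{T,\infty}\ \le\ c\,\sup_{x\in\mathbb{R}^d}\int_0^T\int_{\mathbb{R}^d}g(s,x,z)\,|V(z)|\,dz\,ds,$$ where all quantities take values in $[0,\infty]$. -/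

import Mathlib

open MeasureTheory
open scoped ENNReal

/-- The Gauss-Weierstrass kernel `g(t,x,y) = (4πt)^(-d/2) exp(-|y-x|²/(4t))` on `ℝ^d`;
it is only used for `t > 0`. -/
noncomputable def gaussKernel (d : ℕ) (t : ℝ) (x y : EuclideanSpace ℝ (Fin d)) : ℝ :=
  (4 * Real.pi * t) ^ (-((d : ℝ) / 2)) * Real.exp (-(‖y - x‖ ^ 2 / (4 * t)))

/-- `S(V,t,x,y) = ∫_0^t ∫ g(s,x,z) g(t-s,z,y) / g(t,x,y) |V(z)| dz ds`, with values in
`[0,∞]`. -/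
noncomputable def bridgePotential (d : ℕ) (V : EuclideanSpace ℝ (Fin d) → ℝ) (t : ℝ)
    (x y : EuclideanSpace ℝ (Fin d)) : ℝ≥0∞ :=
  ∫⁻ s in Set.Ioo 0 t, ∫⁻ z : EuclideanSpace ℝ (Fin d),
    ENNReal.ofReal
      (gaussKernel d s x z * gaussKernel d (t - s) z y / gaussKernel d t x y * |V z|)

/-- `‖S(V,t)‖_∞ = sup_{x,y} S(V,t,x,y)`, with values in `[0,∞]`. -/
noncomputable def bridgePotentialSup (d : ℕ) (V : EuclideanSpace ℝ (Fin d) → ℝ) (t : ℝ) :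
    ℝ≥0∞ :=
  ⨆ (x : EuclideanSpace ℝ (Fin d)) (y : EuclideanSpace ℝ (Fin d)), bridgePotential d V t x y

/-- `‖S(V)‖_{T,∞} = sup_{0 < t ≤ T} ‖S(V,t)‖_∞`, with values in `[0,∞]`. -/
noncomputable def bridgePotentialNorm (d : ℕ) (V : EuclideanSpace ℝ (Fin d) → ℝ) (T : ℝ) :
    ℝ≥0∞ :=
  ⨆ t ∈ Set.Ioc 0 T, bridgePotentialSup d V t

/-- The Kato-type quantity `sup_x ∫_0^T ∫ g(s,x,z) |V(z)| dz ds`, with values in `[0,∞]`. -/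
noncomputable def katoQuantity (d : ℕ) (V : EuclideanSpace ℝ (Fin d) → ℝ) (T : ℝ) : ℝ≥0∞ :=
  ⨆ x : EuclideanSpace ℝ (Fin d),
    ∫⁻ s in Set.Ioo 0 T, ∫⁻ z : EuclideanSpace ℝ (Fin d),
      ENNReal.ofReal (gaussKernel d s x z * |V z|)

/-! Lower bound: multiplying the bridge potential by `g(t,x,y)` and integrating over `y` removes the
conditioning, so the Kato integral is an average of bridge potentials.

Upper bound: by `gaussKernel_bridge`, the bridge at time `s` is Gaussian with time parameter
`s(t-s)/t` and centre `x + s v`, `v = (y-x)/t`. Time reversal reduces to `s < t/2`, where this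
parameter is comparable to `s`. While `‖v‖² s ≤ 2`, the drift is within the diffusive scale and
`g(2s,x,·)` dominates. Later times are cut into pieces during which the centre moves at most
`√(t/2)`. On a piece starting at `α`, every Gaussian is dominated by one at time `τ ∈ (t/2,t)`, at a
cost of order `t/s` because `d ≤ 2`. The Gaussian factor to spare limits the time spent near any
`z`, so the `s`-integral gains `1/(‖v‖√α)` (`lintegral_exp_neg_sq_div_le`). Averaging over `τ`
yields the Kato quantity, and the gains sum to a constant over the pieces. -/

/-! ### Gaussian kernels: mass, bridges, comparison -/

lemma gaussKernel_nonneg (d : ℕ) {t : ℝ} (ht : 0 ≤ t) (x y : EuclideanSpace ℝ (Fin d)) :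
    0 ≤ gaussKernel d t x y := by
  unfold gaussKernel
  positivity

lemma gaussKernel_pos (d : ℕ) {t : ℝ} (ht : 0 < t) (x y : EuclideanSpace ℝ (Fin d)) :
    0 < gaussKernel d t x y := by
  unfold gaussKernel
  positivity

lemma Measurable.gaussKernel {α : Type*} [MeasurableSpace α] {d : ℕ} {t : α → ℝ}
    {x y : α → EuclideanSpace ℝ (Fin d)} (ht : Measurable t) (hx : Measurable x)
    (hy : Measurable y) : Measurable fun a => gaussKernel d (t a) (x a) (y a) := by
  unfold _root_.gaussKernel
  fun_prop

lemma lintegral_gaussKernel (d : ℕ) {t : ℝ} (ht : 0 < t) (x : EuclideanSpace ℝ (Fin d)) :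
    ∫⁻ y, ENNReal.ofReal (gaussKernel d t x y) = 1 := by
  have hb : 0 < 1 / (4 * t) := by positivity
  have hI : ∫ v : EuclideanSpace ℝ (Fin d), Real.exp (-(1 / (4 * t)) * ‖v‖ ^ 2)
      = (Real.pi / (1 / (4 * t))) ^ ((d : ℝ) / 2) := by
    simpa using GaussianFourier.integral_rexp_neg_mul_sq_norm
      (V := EuclideanSpace ℝ (Fin d)) hb
  have hpos : 0 < (Real.pi / (1 / (4 * t))) ^ ((d : ℝ) / 2) := by positivity
  have hint : Integrable fun v : EuclideanSpace ℝ (Fin d) =>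
      Real.exp (-(1 / (4 * t)) * ‖v‖ ^ 2) := by
    -- A non-integrable function has integral `0` by convention, so the positive value in `hI`
    -- forces integrability.
    by_contra h
    rw [integral_undef h] at hI
    exact hpos.ne hI
  have hfun : ∀ y, gaussKernel d t x y
      = (4 * Real.pi * t) ^ (-((d : ℝ) / 2)) * Real.exp (-(1 / (4 * t)) * ‖y - x‖ ^ 2) := by
    intro y
    unfold gaussKernel
    congr 2
    ring
  simp_rw [hfun]
  rw [← ofReal_integral_eq_lintegral_ofReal ((hint.comp_sub_right x).const_mul _)
    (Filter.Eventually.of_forall fun y => by positivity), integral_const_mul,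
    integral_sub_right_eq_self (fun v : EuclideanSpace ℝ (Fin d) =>
      Real.exp (-(1 / (4 * t)) * ‖v‖ ^ 2)) x, hI]
  rw [show Real.pi / (1 / (4 * t)) = 4 * Real.pi * t by field_simp,
    ← Real.rpow_add (by positivity)]
  simp

/-- The transition density of the Gaussian bridge is again a Gaussian. -/
lemma gaussKernel_bridge (d : ℕ) {s t : ℝ} (hs : 0 < s) (hst : s < t)
    (x y z : EuclideanSpace ℝ (Fin d)) :
    gaussKernel d s x z * gaussKernel d (t - s) z y / gaussKernel d t x y
      = gaussKernel d (s * (t - s) / t) (x + s • (t⁻¹ • (y - x))) z := by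
  have ht : 0 < t := hs.trans hst
  have hts : 0 < t - s := sub_pos.2 hst
  rw [div_eq_iff (gaussKernel_pos d ht x y).ne']
  unfold gaussKernel
  have h1 : (4 * Real.pi * s) ^ (-((d : ℝ) / 2)) * (4 * Real.pi * (t - s)) ^ (-((d : ℝ) / 2))
      = (4 * Real.pi * (s * (t - s) / t)) ^ (-((d : ℝ) / 2))
        * (4 * Real.pi * t) ^ (-((d : ℝ) / 2)) := by
    rw [← Real.mul_rpow (by positivity) (by positivity),
      ← Real.mul_rpow (by positivity) (by positivity)]
    congr 1
    field_simp
  have h2 : -(‖z - x‖ ^ 2 / (4 * s)) + -(‖y - z‖ ^ 2 / (4 * (t - s)))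
      = -(‖z - (x + s • (t⁻¹ • (y - x)))‖ ^ 2 / (4 * (s * (t - s) / t)))
        + -(‖y - x‖ ^ 2 / (4 * t)) := by
    have e1 : y - z = (y - x) - (z - x) := by abel
    have e2 : z - (x + s • (t⁻¹ • (y - x))) = (z - x) - (s * t⁻¹) • (y - x) := by
      rw [smul_smul]; abel
    rw [e1, e2, norm_sub_sq_real (y - x), norm_sub_sq_real (z - x), norm_smul, inner_smul_right,
      real_inner_comm, mul_pow, Real.norm_eq_abs, sq_abs]
    field_simp
    ring
  calc _ = ((4 * Real.pi * s) ^ (-((d : ℝ) / 2)) * (4 * Real.pi * (t - s)) ^ (-((d : ℝ) / 2)))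
        * (Real.exp (-(‖z - x‖ ^ 2 / (4 * s))) * Real.exp (-(‖y - z‖ ^ 2 / (4 * (t - s))))) := by
        ring
    _ = _ := by
        rw [h1, ← Real.exp_add, h2, Real.exp_add]
        ring

/-- In dimension at most two, widening a Gaussian and moving its centre by at most the new
standard deviation costs a factor proportional to the ratio of the variances, and leaves a
Gaussian factor to spare. -/
lemma gaussKernel_le_mul {d : ℕ} (hd : d ≤ 2) {u τ : ℝ} (hu : 0 < u) (huτ : 2 * u ≤ τ)
    {m m' : EuclideanSpace ℝ (Fin d)} (hm : ‖m - m'‖ ^ 2 ≤ τ) (z : EuclideanSpace ℝ (Fin d)) :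
    gaussKernel d u m z ≤
      Real.exp 1 * (τ / u) * Real.exp (-(‖z - m‖ ^ 2 / (16 * u))) * gaussKernel d τ m' z := by
  have hτ : 0 < τ := by linarith
  have hp : (4 * Real.pi * u) ^ (-((d : ℝ) / 2))
      ≤ τ / u * (4 * Real.pi * τ) ^ (-((d : ℝ) / 2)) := by
    have hq : 4 * Real.pi * u = (4 * Real.pi * τ) * (τ / u)⁻¹ := by field_simp
    have h1 : 1 ≤ τ / u := by rw [le_div_iff₀ hu]; linarith
    have hd' : (d : ℝ) ≤ 2 := by exact_mod_cast hd
    rw [hq, Real.mul_rpow (by positivity) (by positivity), Real.inv_rpow (by positivity),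
      Real.rpow_neg (x := τ / u) (by positivity), inv_inv, mul_comm]
    gcongr
    calc (τ / u) ^ ((d : ℝ) / 2) ≤ (τ / u) ^ (1 : ℝ) :=
          Real.rpow_le_rpow_of_exponent_le h1 (by linarith)
      _ = τ / u := Real.rpow_one _
  -- With `2u ≤ τ`, these weights spend 3/16 of the available 4/16 of `‖z - m‖² / u`, leaving the
  -- spare 1/16; the shift costs at most 3/4 in the exponent, hence the factor `e`.
  have hn : ‖z - m'‖ ^ 2 ≤ 3 / 2 * ‖z - m‖ ^ 2 + 3 * ‖m - m'‖ ^ 2 := by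
    have h := norm_sub_le_norm_sub_add_norm_sub z m m'
    have h0 := norm_nonneg (z - m')
    nlinarith [sq_nonneg (‖z - m‖ - 2 * ‖m - m'‖), norm_nonneg (z - m), norm_nonneg (m - m')]
  have he : -(‖z - m‖ ^ 2 / (4 * u))
      ≤ 1 + -(‖z - m‖ ^ 2 / (16 * u)) + -(‖z - m'‖ ^ 2 / (4 * τ)) := by
    have h1 : ‖z - m'‖ ^ 2 / (4 * τ) ≤ 3 / 8 * ‖z - m‖ ^ 2 / τ + 3 / 4 := by
      rw [div_le_iff₀ (by positivity)]
      have : (3 / 8 * ‖z - m‖ ^ 2 / τ + 3 / 4) * (4 * τ) = 3 / 2 * ‖z - m‖ ^ 2 + 3 * τ := by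
        field_simp
        ring
      linarith
    have h2 : 3 / 8 * ‖z - m‖ ^ 2 / τ ≤ 3 / 8 * ‖z - m‖ ^ 2 / (2 * u) := by gcongr
    have h3 : ‖z - m‖ ^ 2 / (4 * u) = 3 / 8 * ‖z - m‖ ^ 2 / (2 * u) + ‖z - m‖ ^ 2 / (16 * u) := by
      field_simp
      ring
    linarith
  unfold gaussKernel
  calc _ ≤ (τ / u * (4 * Real.pi * τ) ^ (-((d : ℝ) / 2))) *
        Real.exp (1 + -(‖z - m‖ ^ 2 / (16 * u)) + -(‖z - m'‖ ^ 2 / (4 * τ))) := by gcongr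
    _ = _ := by
        rw [Real.exp_add, Real.exp_add]
        ring

/-- The time which a path of constant speed `k` spends, at the parabolic scale, at a given
distance from its starting point. -/
lemma lintegral_exp_neg_sq_div_le {a k α β : ℝ} (ha : 0 ≤ a) (hk : 0 < k) (hα : 0 < α) :
    ∫⁻ s in Set.Ioc α β, ENNReal.ofReal (s⁻¹ * Real.exp (-((a - k * s) ^ 2 / (16 * s))))
      ≤ ENNReal.ofReal (8 * Real.pi / (k * √α)) := by
  rcases le_total β α with hβ | hβ
  · simp [Set.Ioc_eq_empty (not_lt.2 hβ)]
  -- The inner function `(k√s - a/√s)/4` has derivative at least `k/(8√s)`. Since `s⁻¹ ≤ 1/(√α √s)`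
  -- and `exp(-q) ≤ 1/(1+q)`, the integrand is below `F'`.
  set F : ℝ → ℝ := fun s => 8 / (k * √α) * Real.arctan ((k * √s - a / √s) / 4) with hF
  set F' : ℝ → ℝ := fun s => 8 / (k * √α) * (1 / (1 + ((k * √s - a / √s) / 4) ^ 2) *
    ((k * (1 / (2 * √s)) - -a * (1 / (2 * √s)) / √s ^ 2 ) / 4)) with hF'
  have hder : ∀ s ∈ Set.uIcc α β, HasDerivAt F (F' s) s := by
    intro s hs
    rw [Set.uIcc_of_le hβ] at hs
    have hs0 : 0 < s := hα.trans_le hs.1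
    have h1 := Real.hasDerivAt_sqrt hs0.ne'
    have h2 := (((h1.const_mul k).sub ((hasDerivAt_const s a).div h1 (by positivity))).div_const
      4).arctan.const_mul (8 / (k * √α))
    refine HasDerivAt.congr_deriv h2 ?_
    simp [hF']
  have hcont : ContinuousOn F' (Set.Icc α β) := by
    have hne : ∀ s ∈ Set.Icc α β, √s ≠ 0 := fun s hs => (Real.sqrt_pos.2 (hα.trans_le hs.1)).ne'
    simp only [hF']
    refine ContinuousOn.mul (by fun_prop) (ContinuousOn.mul (ContinuousOn.div (by fun_prop) ?_ ?_) ?_)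
    · fun_prop (disch := assumption)
    · intro s _; positivity
    · have : ∀ s ∈ Set.Icc α β, 2 * √s ≠ 0 := fun s hs => mul_ne_zero two_ne_zero (hne s hs)
      have : ∀ s ∈ Set.Icc α β, √s ^ 2 ≠ 0 := fun s hs => pow_ne_zero 2 (hne s hs)
      fun_prop (disch := assumption)
  have hint : IntervalIntegrable F' volume α β :=
    ContinuousOn.intervalIntegrable (by rwa [Set.uIcc_of_le hβ])
  have hle : ∀ s ∈ Set.Ioc α β,
      s⁻¹ * Real.exp (-((a - k * s) ^ 2 / (16 * s))) ≤ F' s := by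
    intro s hs
    have hs0 : 0 < s := hα.trans hs.1
    obtain ⟨r, hr, rfl⟩ : ∃ r, 0 < r ∧ s = r ^ 2 :=
      ⟨√s, Real.sqrt_pos.2 hs0, (Real.sq_sqrt hs0.le).symm⟩
    have hαr : √α ≤ r := Real.sqrt_le_iff.2 ⟨hr.le, hs.1.le⟩
    simp only [hF', Real.sqrt_sq hr.le]
    have h1 : (a - k * r ^ 2) ^ 2 / (16 * r ^ 2) = ((k * r - a / r) / 4) ^ 2 := by
      field_simp
      ring
    rw [h1]
    set q := ((k * r - a / r) / 4) ^ 2 with hq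
    have hq0 : 0 ≤ q := sq_nonneg _
    have h2 : Real.exp (-q) ≤ 1 / (1 + q) := by
      rw [Real.exp_neg, ← one_div]
      exact one_div_le_one_div_of_le (by positivity) (by linarith [Real.add_one_le_exp q])
    have hα0 : 0 < √α := Real.sqrt_pos.2 hα
    have h3 : (r ^ 2)⁻¹ ≤ 8 / (k * √α) * ((k * (1 / (2 * r)) - -a * (1 / (2 * r)) / r ^ 2) / 4) := by
      have h4 : 0 ≤ a * (1 / (2 * r)) / r ^ 2 := by positivity
      calc (r ^ 2)⁻¹ = 8 / (k * r) * (k * (1 / (2 * r)) / 4) := by field_simp; norm_num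
        _ ≤ _ := by
          gcongr
          linarith [neg_mul a (1 / (2 * r)), neg_div (r ^ 2) (a * (1 / (2 * r))),
            congrArg (· / r ^ 2) (neg_mul a (1 / (2 * r)))]
    calc _ ≤ (8 / (k * √α) * ((k * (1 / (2 * r)) - -a * (1 / (2 * r)) / r ^ 2) / 4))
          * (1 / (1 + q)) := by
          gcongr
          exact le_trans (by positivity) h3
      _ = _ := by ring
  calc _ ≤ ∫⁻ s in Set.Ioc α β, ENNReal.ofReal (F' s) :=
        setLIntegral_mono' measurableSet_Ioc fun s hs => ENNReal.ofReal_le_ofReal (hle s hs)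
    _ = ENNReal.ofReal (F β - F α) := by
        rw [← intervalIntegral.integral_eq_sub_of_hasDerivAt hder hint,
          intervalIntegral.integral_of_le hβ, ofReal_integral_eq_lintegral_ofReal]
        · exact (intervalIntegrable_iff_integrableOn_Ioc_of_le hβ).1 hint
        · refine (ae_restrict_iff' measurableSet_Ioc).2 (Filter.Eventually.of_forall fun s hs => ?_)
          have hs0 : 0 < s := hα.trans hs.1
          exact le_trans (by positivity) (hle s hs)
    _ ≤ _ := by
        apply ENNReal.ofReal_le_ofReal
        have h1 := Real.arctan_lt_pi_div_two ((k * √β - a / √β) / 4)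
        have h2 := Real.neg_pi_div_two_lt_arctan ((k * √α - a / √α) / 4)
        have h3 : 0 < 8 / (k * √α) := by
          have := Real.sqrt_pos.2 hα
          positivity
        calc F β - F α = 8 / (k * √α) * (Real.arctan ((k * √β - a / √β) / 4)
              - Real.arctan ((k * √α - a / √α) / 4)) := by simp only [hF]; ring
          _ ≤ 8 / (k * √α) * Real.pi := by gcongr; linarith
          _ = _ := by ring

/-! ### Heat potentials and reduction to half of the bridge -/

/-- The heat semigroup at time `t` applied to `|V|`, evaluated at `x`. -/
noncomputable def heatPotential (d : ℕ) (V : EuclideanSpace ℝ (Fin d) → ℝ) (t : ℝ)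
    (x : EuclideanSpace ℝ (Fin d)) : ℝ≥0∞ :=
  ∫⁻ z : EuclideanSpace ℝ (Fin d), ENNReal.ofReal (gaussKernel d t x z * |V z|)

lemma setLIntegral_heatPotential_le_katoQuantity {d : ℕ} (V : EuclideanSpace ℝ (Fin d) → ℝ)
    {T : ℝ} {S : Set ℝ} (hS : S ⊆ Set.Ioo 0 T) (x : EuclideanSpace ℝ (Fin d)) :
    ∫⁻ s in S, heatPotential d V s x ≤ katoQuantity d V T :=
  (lintegral_mono_set hS).trans
    (le_iSup (fun x => ∫⁻ s in Set.Ioo 0 T, heatPotential d V s x) x)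

lemma setLIntegral_const_sub (f : ℝ → ℝ≥0∞) (a b c : ℝ) :
    ∫⁻ s in Set.Ioo a b, f (c - s) = ∫⁻ s in Set.Ioo (c - b) (c - a), f s := by
  rw [← lintegral_indicator measurableSet_Ioo, ← lintegral_indicator measurableSet_Ioo,
    
    ← lintegral_sub_left_eq_self ((Set.Ioo (c - b) (c - a)).indicator f) c]
  refine lintegral_congr fun s => ?_
  have : s ∈ Set.Ioo a b ↔ c - s ∈ Set.Ioo (c - b) (c - a) := by
    simp only [Set.mem_Ioo]
    constructor <;> rintro ⟨h1, h2⟩ <;> constructor <;> linarith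
  by_cases h : s ∈ Set.Ioo a b
  · rw [Set.indicator_of_mem h, Set.indicator_of_mem (this.1 h)]
  · rw [Set.indicator_of_notMem h, Set.indicator_of_notMem (mt this.2 h)]

lemma setLIntegral_two_mul (f : ℝ → ℝ≥0∞) (t : ℝ) :
    2 * ∫⁻ s in Set.Ioo 0 (t / 2), f (2 * s) = ∫⁻ s in Set.Ioo 0 t, f s := by
  have himg : (fun s : ℝ => 2 * s) '' Set.Ioo 0 (t / 2) = Set.Ioo 0 t := by
    rw [Set.image_mul_left_Ioo two_pos]
    congr 1 <;> ring
  have h := lintegral_image_eq_lintegral_abs_deriv_mul (s := Set.Ioo 0 (t / 2))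
    (f := fun s : ℝ => 2 * s) (f' := fun _ => 2) measurableSet_Ioo
    (fun s _ => by simpa using ((hasDerivAt_id s).const_mul 2).hasDerivWithinAt)
    (fun a _ b _ hab => by simpa using hab) f
  rw [himg] at h
  rw [h, ← lintegral_const_mul' _ _ (by simp)]
  simp

lemma bridgePotential_eq {d : ℕ} (V : EuclideanSpace ℝ (Fin d) → ℝ) (t : ℝ)
    (x y : EuclideanSpace ℝ (Fin d)) :
    bridgePotential d V t x y = ∫⁻ s in Set.Ioo 0 t,
      heatPotential d V (s * (t - s) / t) (x + s • (t⁻¹ • (y - x))) := by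
  unfold bridgePotential heatPotential
  refine setLIntegral_congr_fun measurableSet_Ioo fun s hs => ?_
  simp only [gaussKernel_bridge d hs.1 hs.2]

/-- Time reversal `s ↦ t - s` exchanges the endpoints of the bridge and preserves `s(t-s)/t`. -/
lemma bridgePotential_le_add {d : ℕ} (V : EuclideanSpace ℝ (Fin d) → ℝ) {t : ℝ} (ht : 0 < t)
    (x y : EuclideanSpace ℝ (Fin d)) :
    bridgePotential d V t x y ≤
      (∫⁻ s in Set.Ioo 0 (t / 2),
        heatPotential d V (s * (t - s) / t) (x + s • (t⁻¹ • (y - x)))) +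
      ∫⁻ s in Set.Ioo 0 (t / 2),
        heatPotential d V (s * (t - s) / t) (y + s • (t⁻¹ • (x - y))) := by
  have hsub : Set.Ioo 0 t ⊆ Set.Ioo 0 (t / 2) ∪ Set.Ico (t / 2) t := fun s hs => by
    rcases lt_or_ge s (t / 2) with h | h
    · exact Or.inl ⟨hs.1, h⟩
    · exact Or.inr ⟨h, hs.2⟩
  rw [bridgePotential_eq]
  refine (lintegral_mono_set hsub).trans ((lintegral_union_le _ _ _).trans ?_)
  refine add_le_add le_rfl ?_
  rw [Measure.restrict_congr_set Ioo_ae_eq_Ico.symm]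
  have h := setLIntegral_const_sub (fun s => heatPotential d V (s * (t - s) / t)
    (x + s • (t⁻¹ • (y - x)))) 0 (t / 2) t
  rw [sub_zero, sub_half] at h
  rw [← h]
  refine lintegral_mono fun s => le_of_eq ?_
  congr 1
  · ring
  · rw [sub_smul, smul_smul t, mul_inv_cancel₀ ht.ne', one_smul, ← neg_sub y x, smul_neg, smul_neg]
    abel

/-! ### Upper bound: drift within and beyond the diffusive scale -/

lemma setLIntegral_heatPotential_bridge_near_le {d : ℕ} (hd : d ≤ 2)
    (V : EuclideanSpace ℝ (Fin d) → ℝ) {t T : ℝ} (ht : 0 < t) (htT : t ≤ T)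
    (x v : EuclideanSpace ℝ (Fin d)) :
    ∫⁻ s in Set.Ioo 0 (t / 2) ∩ {s | ‖v‖ ^ 2 * s ≤ 2},
        heatPotential d V (s * (t - s) / t) (x + s • v)
      ≤ ENNReal.ofReal (4 * Real.exp 1) * katoQuantity d V T := by
  have hm : MeasurableSet (Set.Ioo 0 (t / 2) ∩ {s : ℝ | ‖v‖ ^ 2 * s ≤ 2}) :=
    measurableSet_Ioo.inter (measurableSet_le (by fun_prop) (by fun_prop))
  calc _ ≤ ∫⁻ s in Set.Ioo 0 (t / 2) ∩ {s | ‖v‖ ^ 2 * s ≤ 2},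
        ENNReal.ofReal (4 * Real.exp 1) * heatPotential d V (2 * s) x := by
        refine setLIntegral_mono' hm fun s ⟨⟨hs0, hst⟩, hsv⟩ => ?_
        have hsv : ‖v‖ ^ 2 * s ≤ 2 := hsv
        unfold heatPotential
        rw [← lintegral_const_mul' _ _ ENNReal.ofReal_ne_top]
        refine lintegral_mono fun z => ?_
        rw [← ENNReal.ofReal_mul (by positivity), ← mul_assoc]
        have hu : s / 2 ≤ s * (t - s) / t := by
          rw [le_div_iff₀ ht]; nlinarith
        have hu' : s * (t - s) / t ≤ s := by
          rw [div_le_iff₀ ht]; nlinarith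
        have hu0 : 0 < s * (t - s) / t := lt_of_lt_of_le (by positivity) hu
        have h := gaussKernel_le_mul hd hu0 (τ := 2 * s) (by linarith) (m := x + s • v) (m' := x)
          (by
            rw [add_sub_cancel_left, norm_smul, Real.norm_of_nonneg hs0.le]
            nlinarith) z
        have h4 : 2 * s / (s * (t - s) / t) ≤ 4 := by
          rw [div_le_iff₀ hu0]; linarith
        have he : Real.exp (-(‖z - (x + s • v)‖ ^ 2 / (16 * (s * (t - s) / t)))) ≤ 1 :=
          Real.exp_le_one_iff.2 (neg_nonpos.2 (by positivity))
        have hg := gaussKernel_nonneg d (t := 2 * s) (by positivity) x z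
        refine ENNReal.ofReal_le_ofReal (mul_le_mul_of_nonneg_right (h.trans ?_) (abs_nonneg _))
        refine mul_le_mul_of_nonneg_right ?_ hg
        calc _ ≤ Real.exp 1 * 4 * 1 := by gcongr
          _ = _ := by ring
    _ = ENNReal.ofReal (4 * Real.exp 1) * ∫⁻ s in Set.Ioo 0 (t / 2) ∩ {s | ‖v‖ ^ 2 * s ≤ 2},
        heatPotential d V (2 * s) x := lintegral_const_mul' _ _ ENNReal.ofReal_ne_top
    _ ≤ _ := by
        gcongr
        calc _ ≤ ∫⁻ s in Set.Ioo 0 (t / 2), heatPotential d V (2 * s) x :=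
              lintegral_mono_set Set.inter_subset_left
          -- The factor 2 is given away to match the substitution `s ↦ 2s`.
          _ ≤ 2 * ∫⁻ s in Set.Ioo 0 (t / 2), heatPotential d V (2 * s) x :=
              le_mul_of_one_le_left' one_le_two
          _ = ∫⁻ s in Set.Ioo 0 t, heatPotential d V s x :=
              setLIntegral_two_mul (fun s => heatPotential d V s x) t
          _ ≤ _ := setLIntegral_heatPotential_le_katoQuantity V (Set.Ioo_subset_Ioo_right htT) x

/-- The centre stays within `√τ` of `x + α • v`, so one Gaussian serves the whole piece; Tonelli
then leaves, for each `z`, only the time integral of the spare factor. -/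
lemma setLIntegral_heatPotential_bridge_le_heatPotential {d : ℕ} (hd : d ≤ 2)
    {V : EuclideanSpace ℝ (Fin d) → ℝ} (hV : Measurable V) {t α β τ : ℝ} (ht : 0 < t)
    (x v : EuclideanSpace ℝ (Fin d)) (hv : v ≠ 0) (hα : 0 < α) (hβ : β ≤ t / 2)
    (hαβ : ‖v‖ ^ 2 * (β - α) ^ 2 ≤ t / 2) (hτ : τ ∈ Set.Ioo (t / 2) t) :
    ∫⁻ s in Set.Ioc α β, heatPotential d V (s * (t - s) / t) (x + s • v)
      ≤ ENNReal.ofReal (16 * Real.pi * Real.exp 1 * t / (‖v‖ * √α))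
        * heatPotential d V τ (x + α • v) := by
  have hk : 0 < ‖v‖ := norm_pos_iff.2 hv
  have hτ0 : 0 < τ := by linarith [hτ.1]
  set E : ℝ → EuclideanSpace ℝ (Fin d) → ℝ≥0∞ := fun s z =>
    ENNReal.ofReal (s⁻¹ * Real.exp (-((‖z - x‖ - ‖v‖ * s) ^ 2 / (16 * s)))) with hE
  set G : EuclideanSpace ℝ (Fin d) → ℝ≥0∞ := fun z =>
    ENNReal.ofReal (gaussKernel d τ (x + α • v) z * |V z|) with hG
  have hGm : Measurable G :=
    ((measurable_const.gaussKernel measurable_const measurable_id).mul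
      (continuous_abs.measurable.comp hV)).ennreal_ofReal
  have hEm : Measurable (Function.uncurry E) := by
    simp only [hE, Function.uncurry_def]
    fun_prop
  calc _ ≤ ∫⁻ s in Set.Ioc α β, ∫⁻ z,
        ENNReal.ofReal (2 * Real.exp 1 * t) * (E s z * G z) := by
        refine setLIntegral_mono' measurableSet_Ioc fun s ⟨hαs, hsβ⟩ => ?_
        unfold heatPotential
        refine lintegral_mono fun z => ?_
        have hs0 : 0 < s := hα.trans hαs
        have hst : s ≤ t / 2 := hsβ.trans hβ
        have hu : s / 2 ≤ s * (t - s) / t := by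
          rw [le_div_iff₀ ht]; nlinarith
        have hu' : s * (t - s) / t ≤ s := by
          rw [div_le_iff₀ ht]; nlinarith
        have hu4 : 2 * (s * (t - s) / t) ≤ τ := by
          have : s * (t - s) / t ≤ t / 4 := by
            rw [div_le_iff₀ ht]; nlinarith [sq_nonneg (t / 2 - s)]
          linarith [hτ.1]
        have hu0 : 0 < s * (t - s) / t := lt_of_lt_of_le (by positivity) hu
        have h := gaussKernel_le_mul hd hu0 hu4 (m := x + s • v) (m' := x + α • v)
          (by
            rw [add_sub_add_left_eq_sub, ← sub_smul, norm_smul,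
              Real.norm_of_nonneg (sub_nonneg.2 hαs.le), mul_pow]
            have : (s - α) ^ 2 ≤ (β - α) ^ 2 :=
              pow_le_pow_left₀ (sub_nonneg.2 hαs.le) (by linarith) 2
            nlinarith [hτ.1, sq_nonneg ‖v‖]) z
        have h4 : τ / (s * (t - s) / t) ≤ 2 * t * s⁻¹ := by
          rw [div_le_iff₀ hu0]
          calc τ ≤ 2 * t * s⁻¹ * (s / 2) := by
                rw [show 2 * t * s⁻¹ * (s / 2) = t by field_simp]; exact hτ.2.le
            _ ≤ _ := by gcongr
        -- The reverse triangle inequality discards direction and makes the time integral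
        -- one-dimensional.
        have hsq : (‖z - x‖ - ‖v‖ * s) ^ 2 ≤ ‖z - (x + s • v)‖ ^ 2 := by
          rw [sq_le_sq, abs_norm]
          have h5 := abs_norm_sub_norm_le (z - x) (s • v)
          rw [norm_smul, Real.norm_of_nonneg hs0.le, mul_comm] at h5
          rwa [← sub_sub]
        have he : Real.exp (-(‖z - (x + s • v)‖ ^ 2 / (16 * (s * (t - s) / t))))
            ≤ Real.exp (-((‖z - x‖ - ‖v‖ * s) ^ 2 / (16 * s))) := by
          gcongr
        have hg := gaussKernel_nonneg d hτ0.le (x + α • v) z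
        simp only [hE, hG]
        rw [← ENNReal.ofReal_mul (by positivity), ← ENNReal.ofReal_mul (by positivity)]
        refine ENNReal.ofReal_le_ofReal ?_
        calc _ ≤ (Real.exp 1 * (2 * t * s⁻¹)
                * Real.exp (-((‖z - x‖ - ‖v‖ * s) ^ 2 / (16 * s)))
                * gaussKernel d τ (x + α • v) z) * |V z| := by
              refine mul_le_mul_of_nonneg_right (h.trans ?_) (abs_nonneg _)
              refine mul_le_mul_of_nonneg_right ?_ hg
              gcongr
          _ = _ := by ring
    _ = ENNReal.ofReal (2 * Real.exp 1 * t) * ∫⁻ z, (∫⁻ s in Set.Ioc α β, E s z) * G z := by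
        rw [lintegral_lintegral_swap, ← lintegral_const_mul' _ _ (by simp)]
        · refine lintegral_congr fun z => ?_
          rw [lintegral_const_mul' _ _ (by simp), lintegral_mul_const]
          exact hEm.comp (measurable_id.prodMk measurable_const)
        · exact ((hEm.mul (hGm.comp measurable_snd)).const_mul _).aemeasurable
    _ ≤ ENNReal.ofReal (2 * Real.exp 1 * t)
        * ∫⁻ z, ENNReal.ofReal (8 * Real.pi / (‖v‖ * √α)) * G z := by
        gcongr with z
        exact lintegral_exp_neg_sq_div_le (norm_nonneg _) hk hα
    _ = _ := by
        rw [lintegral_const_mul' _ _ (by simp), ← mul_assoc, ← ENNReal.ofReal_mul (by positivity)]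
        congr 2
        ring

/-- The left side does not depend on `τ`; averaging over `τ ∈ (t/2, t)` cancels the factor `t`. -/
lemma setLIntegral_heatPotential_bridge_piece_le {d : ℕ} (hd : d ≤ 2)
    {V : EuclideanSpace ℝ (Fin d) → ℝ} (hV : Measurable V) {t T α β : ℝ} (ht : 0 < t)
    (htT : t ≤ T) (x v : EuclideanSpace ℝ (Fin d)) (hv : v ≠ 0) (hα : 0 < α) (hβ : β ≤ t / 2)
    (hαβ : ‖v‖ ^ 2 * (β - α) ^ 2 ≤ t / 2) :
    ∫⁻ s in Set.Ioc α β, heatPotential d V (s * (t - s) / t) (x + s • v)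
      ≤ ENNReal.ofReal (32 * Real.pi * Real.exp 1 / (‖v‖ * √α)) * katoQuantity d V T := by
  have hk : 0 < ‖v‖ := norm_pos_iff.2 hv
  have hα' := Real.sqrt_pos.2 hα
  set X := ∫⁻ s in Set.Ioc α β, heatPotential d V (s * (t - s) / t) (x + s • v) with hX
  have h1 : X * ENNReal.ofReal (t / 2) ≤
      ENNReal.ofReal (16 * Real.pi * Real.exp 1 * t / (‖v‖ * √α)) * katoQuantity d V T :=
    calc X * ENNReal.ofReal (t / 2) = ∫⁻ _ in Set.Ioo (t / 2) t, X := by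
          rw [setLIntegral_const, Real.volume_Ioo, sub_half]
      _ ≤ ∫⁻ τ in Set.Ioo (t / 2) t,
          ENNReal.ofReal (16 * Real.pi * Real.exp 1 * t / (‖v‖ * √α))
            * heatPotential d V τ (x + α • v) :=
          setLIntegral_mono' measurableSet_Ioo fun τ hτ =>
            setLIntegral_heatPotential_bridge_le_heatPotential hd hV ht x v hv hα hβ hαβ hτ
      _ = _ := lintegral_const_mul' _ _ (by simp)
      _ ≤ _ := by
          gcongr
          exact setLIntegral_heatPotential_le_katoQuantity V
            (Set.Ioo_subset_Ioo (by positivity) htT) _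
  have h2 : ENNReal.ofReal (t / 2) * ENNReal.ofReal (2 / t) = 1 := by
    rw [← ENNReal.ofReal_mul (by positivity)]
    field_simp
    simp
  calc X = X * ENNReal.ofReal (t / 2) * ENNReal.ofReal (2 / t) := by rw [mul_assoc, h2, mul_one]
    _ ≤ ENNReal.ofReal (16 * Real.pi * Real.exp 1 * t / (‖v‖ * √α)) * katoQuantity d V T
        * ENNReal.ofReal (2 / t) := by gcongr
    _ = _ := by
        rw [mul_right_comm, ← ENNReal.ofReal_mul (by positivity)]
        congr 2
        field_simp
        ring

lemma setLIntegral_heatPotential_bridge_pieces_le {d : ℕ} (hd : d ≤ 2)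
    {V : EuclideanSpace ℝ (Fin d) → ℝ} (hV : Measurable V) {t T h : ℝ} (ht : 0 < t)
    (htT : t ≤ T) (x v : EuclideanSpace ℝ (Fin d)) (hv : v ≠ 0) (hh : 0 < h)
    (hvh : ‖v‖ ^ 2 * h ^ 2 ≤ t / 2) (n : ℕ) :
    ∫⁻ s in Set.Ioc (2 / ‖v‖ ^ 2) (min (2 / ‖v‖ ^ 2 + (n + 1) * h) (t / 2)),
        heatPotential d V (s * (t - s) / t) (x + s • v)
      ≤ ENNReal.ofReal (32 * Real.pi * Real.exp 1 * (1 + 2 * √n / (‖v‖ * √h)))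
        * katoQuantity d V T := by
  have hk : 0 < ‖v‖ := norm_pos_iff.2 hv
  have hh' := Real.sqrt_pos.2 hh
  have key : ∀ α β : ℝ, 0 < α → β ≤ α + h →
      ∫⁻ s in Set.Ioc α (min β (t / 2)), heatPotential d V (s * (t - s) / t) (x + s • v)
        ≤ ENNReal.ofReal (32 * Real.pi * Real.exp 1 / (‖v‖ * √α)) * katoQuantity d V T := by
    intro α β hα hβ
    rcases le_total (min β (t / 2)) α with hle | hle
    · simp [Set.Ioc_eq_empty (not_lt.2 hle)]
    · refine setLIntegral_heatPotential_bridge_piece_le hd hV ht htT x v hv hα (min_le_right _ _) ?_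
      refine le_trans ?_ hvh
      gcongr
      linarith [min_le_left β (t / 2)]
  induction n with
  | zero =>
    refine (key _ _ (by positivity) (by simp)).trans ?_
    gcongr
    rw [div_eq_mul_inv]
    gcongr
    have h1 : 1 ≤ ‖v‖ * √(2 / ‖v‖ ^ 2) := by
      rw [Real.sqrt_div (by norm_num), Real.sqrt_sq hk.le, mul_div_cancel₀ _ hk.ne']
      exact Real.one_le_sqrt.2 (by norm_num)
    simpa using inv_le_one_of_one_le₀ h1
  | succ n ih =>
    set α := 2 / ‖v‖ ^ 2 + (n + 1) * h with hα
    have hsub : Set.Ioc (2 / ‖v‖ ^ 2) (min (2 / ‖v‖ ^ 2 + ((n + 1 : ℕ) + 1) * h) (t / 2)) ⊆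
        Set.Ioc (2 / ‖v‖ ^ 2) (min α (t / 2)) ∪
          Set.Ioc α (min (2 / ‖v‖ ^ 2 + ((n + 1 : ℕ) + 1) * h) (t / 2)) := by
      intro s hs
      rcases le_or_gt s α with hsα | hsα
      · exact Or.inl ⟨hs.1, le_min hsα (hs.2.trans (min_le_right _ _))⟩
      · exact Or.inr ⟨hsα, hs.2⟩
    have hα0 : 0 < α := by positivity
    refine (lintegral_mono_set hsub).trans ((lintegral_union_le _ _ _).trans ?_)
    refine (add_le_add ih (key α _ hα0 (by push_cast; linarith))).trans ?_
    rw [← add_mul, ← ENNReal.ofReal_add (by positivity) (by positivity)]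
    gcongr
    have hn0 : 0 < √((n : ℝ) + 1) := Real.sqrt_pos.2 (by positivity)
    have h1 : √((n : ℝ) + 1) * √h ≤ √α := by
      rw [← Real.sqrt_mul (by positivity)]
      exact Real.sqrt_le_sqrt (by rw [hα]; linarith [show 0 < 2 / ‖v‖ ^ 2 by positivity])
    -- Telescoping comparison of the sum of `1/√j` with `2√n`.
    have h2 : 1 / √((n : ℝ) + 1) ≤ 2 * √((n : ℝ) + 1) - 2 * √n := by
      rw [div_le_iff₀ hn0]
      nlinarith [Real.sq_sqrt (show (0 : ℝ) ≤ n by positivity),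
        Real.sq_sqrt (show (0 : ℝ) ≤ (n : ℝ) + 1 by positivity),
        sq_nonneg (√((n : ℝ) + 1) - √n)]
    have h3 : 1 / (‖v‖ * √α) ≤ (2 * √((n : ℝ) + 1) - 2 * √n) / (‖v‖ * √h) :=
      calc 1 / (‖v‖ * √α) ≤ 1 / (‖v‖ * (√((n : ℝ) + 1) * √h)) := by gcongr
        _ = (1 / √((n : ℝ) + 1)) / (‖v‖ * √h) := by field_simp
        _ ≤ _ := by gcongr
    have hD : 0 < 32 * Real.pi * Real.exp 1 := by positivity
    calc _ = 32 * Real.pi * Real.exp 1 * (1 + 2 * √n / (‖v‖ * √h) + 1 / (‖v‖ * √α)) := by ring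
      _ ≤ 32 * Real.pi * Real.exp 1 * (1 + 2 * √n / (‖v‖ * √h)
            + (2 * √((n : ℝ) + 1) - 2 * √n) / (‖v‖ * √h)) := by gcongr
      _ = _ := by push_cast; ring

lemma setLIntegral_heatPotential_bridge_far_le {d : ℕ} (hd : d ≤ 2)
    {V : EuclideanSpace ℝ (Fin d) → ℝ} (hV : Measurable V) {t T : ℝ} (ht : 0 < t)
    (htT : t ≤ T) (x v : EuclideanSpace ℝ (Fin d)) (hv : v ≠ 0) :
    ∫⁻ s in Set.Ioc (2 / ‖v‖ ^ 2) (t / 2), heatPotential d V (s * (t - s) / t) (x + s • v)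
      ≤ ENNReal.ofReal (96 * Real.pi * Real.exp 1) * katoQuantity d V T := by
  have hk : 0 < ‖v‖ := norm_pos_iff.2 hv
  -- The longest step allowed by the drift condition. About `t/(2h)` pieces suffice, and `‖v‖² h =
  -- t/(2h)` makes the sum of their gains at most 2.
  set h := √(t / 2) / ‖v‖ with hh
  have hr : 0 < √(t / 2) := Real.sqrt_pos.2 (by positivity)
  have hh0 : 0 < h := by positivity
  have hvh : ‖v‖ * h = √(t / 2) := by rw [hh]; field_simp
  have hsq : √(t / 2) ^ 2 = t / 2 := Real.sq_sqrt (by positivity)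
  set n := ⌊t / 2 / h⌋₊ with hn
  have hn1 : (n : ℝ) ≤ t / 2 / h := Nat.floor_le (by positivity)
  have hn2 : t / 2 ≤ (n + 1) * h := by
    rw [← div_le_iff₀ hh0]
    exact (Nat.lt_floor_add_one _).le
  have key := setLIntegral_heatPotential_bridge_pieces_le hd hV ht htT x v hv hh0
    (by rw [← mul_pow, hvh, hsq]) n
  rw [min_eq_right (by linarith [show 0 < 2 / ‖v‖ ^ 2 by positivity])] at key
  refine key.trans ?_
  gcongr ENNReal.ofReal ?_ * _
  have hle : 2 * √n / (‖v‖ * √h) ≤ 2 := by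
    rw [div_le_iff₀ (by positivity)]
    gcongr
    refine (Real.sqrt_le_sqrt hn1).trans (Real.sqrt_le_iff.2 ⟨by positivity, ?_⟩)
    rw [mul_pow, Real.sq_sqrt hh0.le, div_le_iff₀ hh0, ← hsq, ← hvh]
    exact le_of_eq (by ring)
  have hD : 0 < 32 * Real.pi * Real.exp 1 := by positivity
  calc _ ≤ 32 * Real.pi * Real.exp 1 * (1 + 2) :=
        mul_le_mul_of_nonneg_left (by linarith) hD.le
    _ = _ := by ring

lemma setLIntegral_heatPotential_bridge_half_le {d : ℕ} (hd : d ≤ 2)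
    {V : EuclideanSpace ℝ (Fin d) → ℝ} (hV : Measurable V) {t T : ℝ} (ht : 0 < t)
    (htT : t ≤ T) (x v : EuclideanSpace ℝ (Fin d)) :
    ∫⁻ s in Set.Ioo 0 (t / 2), heatPotential d V (s * (t - s) / t) (x + s • v)
      ≤ ENNReal.ofReal (4 * Real.exp 1 + 96 * Real.pi * Real.exp 1) * katoQuantity d V T := by
  rw [ENNReal.ofReal_add (by positivity) (by positivity), add_mul]
  have hnear := setLIntegral_heatPotential_bridge_near_le hd V ht htT x v
  by_cases hv : v = 0
  · refine (le_trans (lintegral_mono_set ?_) hnear).trans le_self_add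
    exact fun s hs => ⟨hs, by simp [hv]⟩
  · refine le_trans (lintegral_mono_set ?_) ((lintegral_union_le _ _ _).trans
      (add_le_add hnear (setLIntegral_heatPotential_bridge_far_le hd hV ht htT x v hv)))
    intro s hs
    have hk : 0 < ‖v‖ := norm_pos_iff.2 hv
    rcases le_or_gt (‖v‖ ^ 2 * s) 2 with h | h
    · exact Or.inl ⟨hs, h⟩
    · exact Or.inr ⟨by rwa [div_lt_iff₀' (by positivity)], hs.2.le⟩

lemma bridgePotentialNorm_le {d : ℕ} (hd : d ≤ 2) {V : EuclideanSpace ℝ (Fin d) → ℝ}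
    (hV : Measurable V) (T : ℝ) :
    bridgePotentialNorm d V T
      ≤ ENNReal.ofReal (2 * (4 * Real.exp 1 + 96 * Real.pi * Real.exp 1)) * katoQuantity d V T := by
  refine iSup₂_le fun t ht => iSup₂_le fun x y => ?_
  refine (bridgePotential_le_add V ht.1 x y).trans ((add_le_add
    (setLIntegral_heatPotential_bridge_half_le hd hV ht.1 ht.2 x _)
    (setLIntegral_heatPotential_bridge_half_le hd hV ht.1 ht.2 y _)).trans (le_of_eq ?_))
  rw [← add_mul, ← ENNReal.ofReal_add (by positivity) (by positivity), two_mul]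

/-! ### Lower bound and conclusion -/

/-- Averaging the bridge potential over the endpoint of the bridge gives the heat potential. -/
lemma lintegral_gaussKernel_mul_bridgePotential {d : ℕ} {V : EuclideanSpace ℝ (Fin d) → ℝ}
    (hV : Measurable V) {t : ℝ} (ht : 0 < t) (x : EuclideanSpace ℝ (Fin d)) :
    ∫⁻ y, ENNReal.ofReal (gaussKernel d t x y) * bridgePotential d V t x y
      = ∫⁻ s in Set.Ioo 0 t, heatPotential d V s x := by
  have hV' : Measurable fun z => |V z| := continuous_abs.measurable.comp hV
  calc _ = ∫⁻ y, ∫⁻ s in Set.Ioo 0 t, ∫⁻ z, ENNReal.ofReal (gaussKernel d s x z * |V z|) *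
        ENNReal.ofReal (gaussKernel d (t - s) z y) := by
        refine lintegral_congr fun y => ?_
        rw [bridgePotential, ← lintegral_const_mul' _ _ ENNReal.ofReal_ne_top]
        refine setLIntegral_congr_fun measurableSet_Ioo fun s hs => ?_
        rw [← lintegral_const_mul' _ _ ENNReal.ofReal_ne_top]
        refine lintegral_congr fun z => ?_
        have hg := gaussKernel_pos d ht x y
        rw [← ENNReal.ofReal_mul hg.le, ← ENNReal.ofReal_mul
          (mul_nonneg (gaussKernel_nonneg d hs.1.le x z) (abs_nonneg _))]
        congr 1
        field_simp
    _ = ∫⁻ s in Set.Ioo 0 t, ∫⁻ y, ∫⁻ z, ENNReal.ofReal (gaussKernel d s x z * |V z|) *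
        ENNReal.ofReal (gaussKernel d (t - s) z y) := by
        rw [lintegral_lintegral_swap]
        refine (Measurable.lintegral_prod_right' (f := fun p : (EuclideanSpace ℝ (Fin d) × ℝ) ×
          EuclideanSpace ℝ (Fin d) => ENNReal.ofReal (gaussKernel d p.1.2 x p.2 * |V p.2|) *
            ENNReal.ofReal (gaussKernel d (t - p.1.2) p.2 p.1.1)) ?_).aemeasurable
        refine Measurable.mul (Measurable.ennreal_ofReal (Measurable.mul ?_
          (hV'.comp measurable_snd))) (Measurable.ennreal_ofReal ?_)
        · exact Measurable.gaussKernel (by fun_prop) (by fun_prop) (by fun_prop)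
        · exact Measurable.gaussKernel (by fun_prop) (by fun_prop) (by fun_prop)
    _ = _ := by
        refine setLIntegral_congr_fun measurableSet_Ioo fun s hs => ?_
        -- With `y` integrated first, the second kernel has mass one.
        rw [lintegral_lintegral_swap]
        · unfold heatPotential
          refine lintegral_congr fun z => ?_
          rw [lintegral_const_mul' _ _ ENNReal.ofReal_ne_top,
            lintegral_gaussKernel d (sub_pos.2 hs.2), mul_one]
        · refine (Measurable.mul (Measurable.ennreal_ofReal (Measurable.mul ?_
            (hV'.comp measurable_snd))) (Measurable.ennreal_ofReal ?_)).aemeasurable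
          · exact Measurable.gaussKernel (by fun_prop) (by fun_prop) (by fun_prop)
          · exact Measurable.gaussKernel (by fun_prop) (by fun_prop) (by fun_prop)

lemma katoQuantity_le_bridgePotentialNorm {d : ℕ} {V : EuclideanSpace ℝ (Fin d) → ℝ}
    (hV : Measurable V) {T : ℝ} (hT : 0 < T) :
    katoQuantity d V T ≤ bridgePotentialNorm d V T := by
  refine iSup_le fun x => ?_
  have hS : ∀ y, bridgePotential d V T x y ≤ bridgePotentialNorm d V T := fun y =>
    (le_iSup₂ (f := fun x y => bridgePotential d V T x y) x y).trans
      (le_iSup₂ (f := fun t (_ : t ∈ Set.Ioc 0 T) => bridgePotentialSup d V t) T ⟨hT, le_rfl⟩)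
  calc _ = ∫⁻ y, ENNReal.ofReal (gaussKernel d T x y) * bridgePotential d V T x y :=
        (lintegral_gaussKernel_mul_bridgePotential hV hT x).symm
    _ ≤ ∫⁻ y, ENNReal.ofReal (gaussKernel d T x y) * bridgePotentialNorm d V T := by
        gcongr with y
        exact hS y
    _ = bridgePotentialNorm d V T := by
        have hm : Measurable fun y => ENNReal.ofReal (gaussKernel d T x y) :=
          (measurable_const.gaussKernel measurable_const measurable_id).ennreal_ofReal
        rw [lintegral_mul_const _ hm, lintegral_gaussKernel d hT, one_mul]

theorem theorem4 :
    ∃ c : ℝ, 0 < c ∧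
      ∀ d : ℕ, d = 1 ∨ d = 2 →
        ∀ T : ℝ, 0 < T →
          ∀ V : EuclideanSpace ℝ (Fin d) → ℝ, Measurable V →
            ENNReal.ofReal c⁻¹ * katoQuantity d V T ≤ bridgePotentialNorm d V T ∧
              bridgePotentialNorm d V T ≤ ENNReal.ofReal c * katoQuantity d V T := by
  have hc : 1 ≤ 2 * (4 * Real.exp 1 + 96 * Real.pi * Real.exp 1) := by
    have h1 : 1 ≤ Real.exp 1 := Real.one_le_exp zero_le_one
    have h2 : 0 < 96 * Real.pi * Real.exp 1 := by positivity
    linarith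
  refine ⟨2 * (4 * Real.exp 1 + 96 * Real.pi * Real.exp 1), by positivity,
    fun d hd T hT V hV => ⟨?_, bridgePotentialNorm_le (by omega) hV T⟩⟩
  calc _ ≤ 1 * katoQuantity d V T := by
        gcongr
        exact ENNReal.ofReal_le_one.2 (inv_le_one_of_one_le₀ hc)
    _ = katoQuantity d V T := one_mul _
    _ ≤ _ := katoQuantity_le_bridgePotentialNorm hV hT
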